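/- Let $V$ be a finite-dimensional real vector space with a scalar product $\langle\cdot,\cdot\rangle$, and let $G\subset \mathrm{GL}(V)$ be a closed connected subgroup which is closed under transpose with respect to $\langle\cdot,\cdot\rangle$. Let $\mathfrak g=\{\xi\in\mathrm{End}(V):\exp(t\xi)\in G\ \forall t\in\mathbb R\}$ be its Lie algebra, let $\mathfrak p=\mathfrak g\cap\mathrm{Sym}(V)$, where $\mathrm{Sym}(V)$ is the space of symmetric endomorphisms of $V$, let $\mathfrak a\subset\mathfrak p$ be an Abelian subalgebra, and let $A=\exp(\mathfrak a)$. Let $\mu_{\mathfrak a}:V\to\mathfrak a^*$, $\mu_{\mathfrak a}(x)(\xi)=\langle \xi x,x\rangle$, be the corresponding gradient map, i.e. $\mu_{\mathfrak a}(x)(\xi)=\frac{d}{dt}\big|_{t=0}\frac12\left(\|\exp(t\xi)x\|^2-\|x\|^2\right)$. For every $x\in V$ there exists $v\in G\cdot x$ such that $$\mu_{\mathfrak a}\big(\overline{G\cdot x}\big)=\mu_{\mathfrak a}\big(\overline{A\cdot v}\big).$$ Moreover, $\mu_{\mathfrak a}\big(\overline{G\cdot x}\big)$ is a polyhedral cone,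 i.e. the intersection of finitely many closed linear half-spaces of $\mathfrak a^*$ (the empty intersection being $\mathfrak a^*$). -/

import Mathlib

open scoped InnerProductSpace

attribute [local instance 100] LieRing.ofAssociativeRing

noncomputable section

namespace GradientMap

variable {V : Type*} [NormedAddCommGroup V] [InnerProductSpace ℝ V]

/-- A subgroup `G` of `GL(V)` (the group of units of `V →L[ℝ] V`) is closed under transpose with
respect to the scalar product of `V`: for every `g ∈ G` there is `h ∈ G` with `h = gᵀ`. -/
def ClosedUnderTranspose (G : Subgroup (V →L[ℝ] V)ˣ) : Prop :=
  ∀ g ∈ G, ∃ h ∈ G, ∀ x y : V,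
    ⟪(h : V →L[ℝ] V) x, y⟫_ℝ = ⟪x, (g : V →L[ℝ] V) y⟫_ℝ

/-- The (underlying set of the) Lie algebra `𝔤` of a closed linear group `G ⊆ GL(V)`:
all endomorphisms `ξ` whose one-parameter group `t ↦ exp (t ξ)` lies in `G`. -/
def lieAlg (G : Subgroup (V →L[ℝ] V)ˣ) : Set (V →L[ℝ] V) :=
  {ξ | ∀ t : ℝ, ∃ g ∈ G, (g : V →L[ℝ] V) = NormedSpace.exp (t • ξ)}

/-- `𝔭 = 𝔤 ∩ Sym(V)`. -/
def symPart (G : Subgroup (V →L[ℝ] V)ˣ) : Set (V →L[ℝ] V) :=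
  {ξ | ξ ∈ lieAlg G ∧ (ξ : V →ₗ[ℝ] V).IsSymmetric}

/-- Elements of an Abelian Lie algebra of endomorphisms commute. -/
theorem commute_of_mem (𝔞 : LieSubalgebra ℝ (V →L[ℝ] V)) [IsLieAbelian 𝔞]
    {ξ η : V →L[ℝ] V} (hξ : ξ ∈ 𝔞) (hη : η ∈ 𝔞) : Commute ξ η := by
  have h : ⁅(⟨ξ, hξ⟩ : 𝔞), (⟨η, hη⟩ : 𝔞)⁆ = 0 := trivial_lie_zero 𝔞 𝔞 _ _
  have h' : ⁅ξ, η⁆ = 0 := congrArg (fun z : 𝔞 => (z : V →L[ℝ] V)) h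
  rw [Ring.lie_def, sub_eq_zero] at h'
  exact h'

/-- The exponential of an endomorphism of a finite dimensional space, as an element of `GL(V)`. -/
theorem exists_unit_exp [FiniteDimensional ℝ V] (ξ : V →L[ℝ] V) :
    ∃ u : (V →L[ℝ] V)ˣ, (u : V →L[ℝ] V) = NormedSpace.exp ξ := by
  have : CompleteSpace V := FiniteDimensional.complete ℝ V
  let _ : NormedAlgebra ℚ (V →L[ℝ] V) := NormedAlgebra.restrictScalars ℚ ℝ (V →L[ℝ] V)
  exact NormedSpace.isUnit_exp ξ

/-- The Abelian subgroup `A = exp(𝔞)` of `GL(V)` attached to an Abelian Lie subalgebra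
`𝔞` of `End(V)`. -/
def expGroup [FiniteDimensional ℝ V] (𝔞 : LieSubalgebra ℝ (V →L[ℝ] V)) [IsLieAbelian 𝔞] :
    Subgroup (V →L[ℝ] V)ˣ where
  carrier := {u | ∃ ξ ∈ 𝔞, (u : V →L[ℝ] V) = NormedSpace.exp ξ}
  one_mem' := ⟨0, 𝔞.zero_mem, by simp [NormedSpace.exp_zero]⟩
  mul_mem' := by
    rintro a b ⟨ξ, hξ, ha⟩ ⟨η, hη, hb⟩
    have : CompleteSpace V := FiniteDimensional.complete ℝ V
    let _ : NormedAlgebra ℚ (V →L[ℝ] V) := NormedAlgebra.restrictScalars ℚ ℝ (V →L[ℝ] V)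
    exact ⟨ξ + η, 𝔞.add_mem hξ hη, by
      rw [NormedSpace.exp_add_of_commute (commute_of_mem 𝔞 hξ hη), Units.val_mul, ha, hb]⟩
  inv_mem' := by
    rintro a ⟨ξ, hξ, ha⟩
    have : CompleteSpace V := FiniteDimensional.complete ℝ V
    let _ : NormedAlgebra ℚ (V →L[ℝ] V) := NormedAlgebra.restrictScalars ℚ ℝ (V →L[ℝ] V)
    refine ⟨-ξ, 𝔞.neg_mem hξ, ?_⟩
    rw [Units.inv_eq_of_mul_eq_one_right]
    rw [ha, ← NormedSpace.exp_add_of_commute (Commute.neg_right (Commute.refl ξ)),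
      add_neg_cancel, NormedSpace.exp_zero]

/-- The Kempf-Ness function `Ψ(x, g) = (‖g x‖² - ‖x‖²) / 2`. -/
def kempfNess (x : V) (g : V →L[ℝ] V) : ℝ := (‖g x‖ ^ 2 - ‖x‖ ^ 2) / 2

/-- The gradient map `μ_𝔞 : V → 𝔞^*`, `μ_𝔞(x)(ξ) = ⟨ξ x, x⟩`. -/
def gradientMap (𝔞 : LieSubalgebra ℝ (V →L[ℝ] V)) (x : V) : Module.Dual ℝ 𝔞 where
  toFun ξ := ⟪(ξ : V →L[ℝ] V) x, x⟫_ℝ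
  map_add' ξ η := by simp [inner_add_left]
  map_smul' c ξ := by simp [inner_smul_left]

/-- `μ_𝔞(x)(ξ)` is the derivative at `t = 0` of the Kempf-Ness function along `exp (t ξ)`. -/
theorem hasDerivAt_kempfNess [FiniteDimensional ℝ V] (𝔞 : LieSubalgebra ℝ (V →L[ℝ] V))
    (x : V) (ξ : 𝔞) :
    HasDerivAt (fun t : ℝ => kempfNess x (NormedSpace.exp (t • (ξ : V →L[ℝ] V))))
      (gradientMap 𝔞 x ξ) 0 := by
  have : CompleteSpace V := FiniteDimensional.complete ℝ V
  have h1 : HasDerivAt (fun t : ℝ => NormedSpace.exp (t • (ξ : V →L[ℝ] V)))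
      (ξ : V →L[ℝ] V) 0 := by
    simpa using hasDerivAt_exp_smul_const (𝕂 := ℝ) (ξ : V →L[ℝ] V) (0 : ℝ)
  have h2 : HasDerivAt (fun t : ℝ => NormedSpace.exp (t • (ξ : V →L[ℝ] V)) x)
      ((ξ : V →L[ℝ] V) x) 0 := by
    simpa using h1.clm_apply (hasDerivAt_const (0 : ℝ) x)
  have h3 := ((h2.norm_sq).sub_const (‖x‖ ^ 2)).div_const 2
  have h4 : 2 * ⟪NormedSpace.exp ((0 : ℝ) • (ξ : V →L[ℝ] V)) x, (ξ : V →L[ℝ] V) x⟫_ℝ / 2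
      = gradientMap 𝔞 x ξ := by
    simp [gradientMap, NormedSpace.exp_zero, real_inner_comm]
  rw [h4] at h3
  exact h3

/-- A polyhedral cone in a finite dimensional real vector space: the intersection of finitely
many closed linear half-spaces `{y | 0 ≤ f y}`. -/
def IsPolyhedralCone {E : Type*} [AddCommGroup E] [Module ℝ E] (C : Set E) : Prop :=
  ∃ s : Finset (Module.Dual ℝ E), C = {y | ∀ f ∈ s, 0 ≤ f y}

end GradientMap

end

/-! In an orthonormal basis `b` of joint eigenvectors of `𝔞`, the gradient map at `y` is the sum of
the weights with coefficients `⟪b i, y⟫ ^ 2`. On the closure of `G • x` its values therefore lie in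
the cone spanned by the weights whose coordinate is not identically zero on the orbit. A connected
orbit covered by finitely many subspaces lies in one of them
(`exists_orbit_subset_of_subset_iUnion`), so some `v` in the orbit has all of these coordinates
nonzero.

For such `v`, each `β` in the cone is attained on the closure of `A • v`: minimise `‖exp ξ v‖ ^ 2 /
2 - β ξ` over `𝔞` and pass to a limit of the points `exp ξ v` (`coneOf_subset_image_closure_orbit`).
Since `A • v ⊆ G • x`, both images equal the cone, which is polyhedral by Fourier-Motzkin
elimination. -/

namespace GradientMap

/-! ### Finitely generated cones are polyhedral -/

section Polyhedral

variable {E : Type*} [AddCommGroup E] [Module ℝ E]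

theorem isPolyhedralCone_zero [FiniteDimensional ℝ E] : IsPolyhedralCone ({0} : Set E) := by
  classical
  let b := Module.finBasis ℝ E
  refine ⟨Finset.univ.image b.coord ∪ Finset.univ.image (fun i => -b.coord i), ?_⟩
  ext y
  simp only [Set.mem_singleton_iff, Set.mem_ofPred_eq, Finset.mem_union, Finset.mem_image,
    Finset.mem_univ, true_and]
  constructor
  · rintro rfl f -
    simp
  · intro h
    refine b.forall_coord_eq_zero_iff.mp fun i => le_antisymm ?_ (h _ (Or.inl ⟨i, rfl⟩))
    simpa using h _ (Or.inr ⟨i, rfl⟩)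

/-- Fourier-Motzkin elimination: adding a ray to a polyhedral cone gives a polyhedral cone. -/
theorem IsPolyhedralCone.add_ray {C : Set E} (hC : IsPolyhedralCone C) (v : E) :
    IsPolyhedralCone {y | ∃ t : ℝ, 0 ≤ t ∧ y - t • v ∈ C} := by
  classical
  obtain ⟨s, rfl⟩ := hC
  -- Keep the constraints nonnegative on `v`; combine each one positive on `v` with each one
  -- negative on `v` so that the result vanishes on `v`.
  refine ⟨s.filter (fun f => 0 ≤ f v) ∪
    ((s.filter (fun f => 0 < f v) ×ˢ s.filter (fun g => g v < 0)).image
      fun p => p.1 v • p.2 - p.2 v • p.1), ?_⟩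
  ext y
  simp only [Set.mem_ofPred_eq, map_sub, map_smul, smul_eq_mul, sub_nonneg]
  constructor
  · rintro ⟨t, ht, h⟩ f hf
    simp only [Finset.mem_union, Finset.mem_filter, Finset.mem_image, Finset.mem_product,
      Prod.exists] at hf
    rcases hf with ⟨hf, hfv⟩ | ⟨p, q, ⟨⟨hp, hpv⟩, hq, hqv⟩, rfl⟩
    · exact (mul_nonneg ht hfv).trans (h f hf)
    · have h1 := mul_le_mul_of_nonneg_left (h q hq) hpv.le
      have h2 := mul_le_mul_of_nonneg_left (h p hp) (neg_nonneg.mpr hqv.le)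
      simp only [LinearMap.sub_apply, LinearMap.smul_apply, smul_eq_mul]
      linarith
  · intro h
    -- These are all the lower bounds on `t`; their maximum is the least candidate, hence the best
    -- one for the upper bounds.
    let T : Finset ℝ := insert 0 ((s.filter (fun g => g v < 0)).image fun g => g y / g v)
    have hT : T.Nonempty := ⟨0, Finset.mem_insert_self _ _⟩
    refine ⟨T.max' hT, T.le_max' _ (Finset.mem_insert_self _ _), fun f hf => ?_⟩
    rcases lt_trichotomy (f v) 0 with hfv | hfv | hfv
    · rw [← div_le_iff_of_neg hfv]
      exact T.le_max' _ (Finset.mem_insert_of_mem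
        (Finset.mem_image_of_mem _ (Finset.mem_filter.mpr ⟨hf, hfv⟩)))
    · rw [hfv, mul_zero]
      exact h f (Finset.mem_union_left _ (Finset.mem_filter.mpr ⟨hf, hfv.ge⟩))
    · rcases Finset.mem_insert.mp (T.max'_mem hT) with h0 | h0
      · rw [h0, zero_mul]
        exact h f (Finset.mem_union_left _ (Finset.mem_filter.mpr ⟨hf, hfv.le⟩))
      · obtain ⟨g, hg, hgy⟩ := Finset.mem_image.mp h0
        have hgv := (Finset.mem_filter.mp hg).2
        have := h (f v • g - g v • f) (Finset.mem_union_right _ (Finset.mem_image.mpr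
          ⟨(f, g), Finset.mem_product.mpr ⟨Finset.mem_filter.mpr ⟨hf, hfv⟩, hg⟩, rfl⟩))
        simp only [LinearMap.sub_apply, LinearMap.smul_apply, smul_eq_mul] at this
        rw [← hgy, div_mul_eq_mul_div, div_le_iff_of_neg hgv]
        linarith

/-- The convex cone generated by the vectors `w i`, `i ∈ s`. -/
def coneOf {ι : Type*} (s : Finset ι) (w : ι → E) : Set E :=
  {y | ∃ c : ι → ℝ, (∀ i, 0 ≤ c i) ∧ y = ∑ i ∈ s, c i • w i}

/-- A finitely generated convex cone is polyhedral. -/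
theorem isPolyhedralCone_coneOf [FiniteDimensional ℝ E] {ι : Type*} (s : Finset ι) (w : ι → E) :
    IsPolyhedralCone (coneOf s w) := by
  classical
  induction s using Finset.induction_on with
  | empty =>
    convert! isPolyhedralCone_zero (E := E)
    ext y
    exact ⟨fun ⟨_, _, h⟩ => by simpa using h, fun h => ⟨0, fun _ => le_rfl, by simpa using h⟩⟩
  | insert a s ha ih =>
    convert! ih.add_ray (w a)
    ext y
    constructor
    · rintro ⟨c, hc, rfl⟩
      refine ⟨c a, hc a, c, hc, ?_⟩
      rw [Finset.sum_insert ha, add_sub_cancel_left]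
    · rintro ⟨t, ht, c, hc, h⟩
      refine ⟨Function.update c a t, fun i => ?_, ?_⟩
      · by_cases hi : i = a
        · subst hi; simpa using ht
        · simpa [hi] using hc i
      · rw [Finset.sum_insert ha, Function.update_self, ← sub_eq_iff_eq_add', h]
        refine Finset.sum_congr rfl fun i hi => ?_
        rw [Function.update_of_ne (ne_of_mem_of_not_mem hi ha)]

end Polyhedral

/-! ### Connected orbits and finite unions of subspaces -/

section Generic

variable {V : Type*} [NormedAddCommGroup V] [NormedSpace ℝ V] [FiniteDimensional ℝ V]

/-- If a connected orbit of a linear group is covered by finitely many linear subspaces, then it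
is contained in one of them. -/
theorem exists_orbit_subset_of_subset_iUnion (G : Subgroup (V →L[ℝ] V)ˣ)
    (x : V) (hO : IsPreconnected (MulAction.orbit G x)) {ι : Type*} [Finite ι]
    (W : ι → Submodule ℝ V) (hW : MulAction.orbit G x ⊆ ⋃ i, (W i : Set V)) :
    ∃ i, MulAction.orbit G x ⊆ W i := by
  classical
  set O := MulAction.orbit G x with hOdef
  -- `P S` says that `S` contains a nonempty relatively open part of the orbit
  let P : Submodule ℝ V → Prop := fun S => ∃ U : Set V, IsOpen U ∧ (U ∩ O).Nonempty ∧ U ∩ O ⊆ S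
  have hPW : ∃ i, P (W i) := by
    by_contra! hcon
    have key : ∀ s : Finset ι, ∃ U : Set V, IsOpen U ∧ (U ∩ O).Nonempty ∧
        ∀ i ∈ s, Disjoint (U ∩ O) (W i : Set V) := by
      intro s
      induction s using Finset.induction_on with
      | empty => exact ⟨Set.univ, isOpen_univ, ⟨x, trivial, MulAction.mem_orbit_self x⟩, by simp⟩
      | insert a s ha ih =>
        obtain ⟨U, hU, hne, hd⟩ := ih
        refine ⟨U ∩ (W a : Set V)ᶜ, hU.inter (W a).closed_of_finiteDimensional.isOpen_compl, ?_, ?_⟩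
        · by_contra hemp
          refine hcon a ⟨U, hU, hne, fun y hy => ?_⟩
          by_contra hya
          exact hemp ⟨y, ⟨hy.1, hya⟩, hy.2⟩
        · intro i hi
          rw [Set.disjoint_left]
          rintro y ⟨⟨hyU, hya⟩, hyO⟩ hyi
          rcases Finset.mem_insert.mp hi with rfl | hi
          · exact hya hyi
          · exact Set.disjoint_left.mp (hd i hi) ⟨hyU, hyO⟩ hyi
    have := Fintype.ofFinite ι
    obtain ⟨U, -, ⟨y, hy⟩, hd⟩ := key Finset.univ
    obtain ⟨i, hi⟩ := Set.mem_iUnion.mp (hW hy.2)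
    exact Set.disjoint_left.mp (hd i (Finset.mem_univ i)) hy hi
  obtain ⟨i, hi⟩ := hPW
  -- A subspace of least dimension containing an open piece of the orbit is rigid; connectedness
  -- will spread it over the whole orbit.
  obtain ⟨S, ⟨U, hU, ⟨u, huU, huO⟩, hUS⟩, hmin⟩ :=
    exists_minimalFor_of_wellFoundedLT P (fun S => Module.finrank ℝ S) ⟨_, hi⟩
  have hle : ∀ T, P T → P (S ⊓ T) → S ≤ T := fun T _ hST =>
    inf_eq_left.mp (Submodule.eq_of_le_of_finrank_le inf_le_left
      (hmin hST (Submodule.finrank_mono inf_le_left)))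
  let good : Set O := {y | ∃ N : Set V, IsOpen N ∧ (y : V) ∈ N ∧ N ∩ O ⊆ S}
  have hopen : IsOpen good := by
    rw [isOpen_iff_mem_nhds]
    rintro y ⟨N, hN, hyN, hNS⟩
    filter_upwards [(hN.preimage continuous_subtype_val).mem_nhds hyN] with z hz
    exact ⟨N, hN, hz, hNS⟩
  have hclosed : IsClosed good := by
    refine isClosed_of_closure_subset fun y hy => ?_
    -- The translate `g S` contains the orbit near `y`. Good points accumulate at `y`, so `S ⊓ g S`
    -- contains an open piece, and minimality with equal dimensions gives `g S = S`.
    obtain ⟨g, hg⟩ : ∃ g : G, g • u = y := by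
      rw [← MulAction.orbit_eq_iff.mpr huO] at hOdef
      exact MulAction.mem_orbit_iff.mp (hOdef ▸ y.2)
    let T : Submodule ℝ V := S.map (g : (V →L[ℝ] V)ˣ).val.toLinearMap
    let N : Set V := {z | g⁻¹ • z ∈ U}
    have hN : IsOpen N := hU.preimage (((g⁻¹ : G) : (V →L[ℝ] V)ˣ) : V →L[ℝ] V).continuous
    have hyN : (y : V) ∈ N := by
      change g⁻¹ • (y : V) ∈ U
      rwa [← hg, inv_smul_smul]
    have hNT : N ∩ O ⊆ T := fun z hz =>
      ⟨g⁻¹ • z, hUS ⟨hz.1, MulAction.mapsTo_smul_orbit g⁻¹ x hz.2⟩, smul_inv_smul g z⟩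
    obtain ⟨z, hzN, N', hN', hzN', hNS'⟩ :=
      mem_closure_iff.mp hy _ (hN.preimage continuous_subtype_val) hyN
    have hST : S ≤ T := hle T ⟨N, hN, ⟨y, hyN, y.2⟩, hNT⟩
      ⟨N ∩ N', hN.inter hN', ⟨z, ⟨hzN, hzN'⟩, z.2⟩,
        fun a ha => ⟨hNS' ⟨ha.1.2, ha.2⟩, hNT ⟨ha.1.1, ha.2⟩⟩⟩
    have hTS : T = S :=
      (Submodule.eq_of_le_of_finrank_le hST (Submodule.finrank_map_le _ S)).symm
    exact ⟨N, hN, hyN, hTS ▸ hNT⟩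
  have := Subtype.preconnectedSpace hO
  have huniv : good = Set.univ :=
    IsClopen.eq_univ ⟨hclosed, hopen⟩ ⟨⟨u, huO⟩, U, hU, huU, hUS⟩
  have hOS : O ⊆ S := fun y hy => by
    obtain ⟨N, -, hyN, hNS⟩ : (⟨y, hy⟩ : O) ∈ good := huniv ▸ Set.mem_univ _
    exact hNS ⟨hyN, hy⟩
  refine ⟨i, hOS.trans (hle _ hi ?_)⟩
  obtain ⟨U', hU', hne, hUW⟩ := hi
  exact ⟨U', hU', hne, fun y hy => ⟨hOS hy.2, hUW hy⟩⟩

end Generic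

/-! ### Weights and the image of the closure of an `A`-orbit -/

section Weights

variable {V : Type*} [NormedAddCommGroup V] [InnerProductSpace ℝ V]
  {𝔞 : LieSubalgebra ℝ (V →L[ℝ] V)}

/-- The gradient map is the combination of the weights with the squared coordinates as
coefficients. -/
theorem gradientMap_eq_sum {ι : Type*} [Fintype ι]
    (hsymm : ∀ ξ ∈ 𝔞, ((ξ : V →L[ℝ] V) : V →ₗ[ℝ] V).IsSymmetric)
    (b : OrthonormalBasis ι ℝ V)
    (hb : ∀ i, ∀ ξ : 𝔞, (ξ : V →L[ℝ] V) (b i) = gradientMap 𝔞 (b i) ξ • b i) (x : V) :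
    gradientMap 𝔞 x = ∑ i, ⟪b i, x⟫_ℝ ^ 2 • gradientMap 𝔞 (b i) := by
  ext ξ
  rw [LinearMap.sum_apply]
  change ⟪(ξ : V →L[ℝ] V) x, x⟫_ℝ = _
  rw [← b.sum_inner_mul_inner]
  refine Finset.sum_congr rfl fun i _ => ?_
  have h : ⟪(ξ : V →L[ℝ] V) x, b i⟫_ℝ = ⟪x, (ξ : V →L[ℝ] V) (b i)⟫_ℝ := hsymm ξ ξ.2 x (b i)
  rw [h, hb, real_inner_smul_right, LinearMap.smul_apply, smul_eq_mul, real_inner_comm]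
  ring

variable [FiniteDimensional ℝ V]

/-- A commuting family of symmetric operators has an orthonormal basis of joint eigenvectors. -/
theorem exists_orthonormalBasis_joint_eigenvectors {J : Type*} (T : J → V →ₗ[ℝ] V)
    (hT : ∀ j, (T j).IsSymmetric) (hC : Pairwise fun i j => Commute (T i) (T j)) :
    ∃ b : OrthonormalBasis (Fin (Module.finrank ℝ V)) ℝ V, ∀ i, ∃ χ : J → ℝ,
      ∀ j, T j (b i) = χ j • b i := by
  classical
  have hfam := LinearMap.IsSymmetric.orthogonalFamily_iInf_eigenspaces hT
  have hint := LinearMap.IsSymmetric.directSum_isInternal_of_pairwise_commute hT hC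
  -- `J` may be infinite, but only finitely many independent joint eigenspaces are nonzero.
  have hfin := WellFoundedGT.finite_ne_bot_of_iSupIndep hint.submodule_iSupIndep
  have hint' := DirectSum.isInternal_ne_bot_iff.mpr hint
  have : Fintype {χ : J → ℝ // (⨅ j, Module.End.eigenspace (T j) (χ j)) ≠ ⊥} := hfin.fintype
  have hfam' := hfam.comp (Subtype.val_injective
    (p := fun χ : J → ℝ => (⨅ j, Module.End.eigenspace (T j) (χ j)) ≠ ⊥))
  refine ⟨hint'.subordinateOrthonormalBasis rfl hfam', fun i =>
    ⟨(hint'.subordinateOrthonormalBasisIndex rfl i hfam').1, fun j => ?_⟩⟩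
  have := hint'.subordinateOrthonormalBasis_subordinate rfl i hfam'
  exact Module.End.mem_eigenspace_iff.mp ((Submodule.mem_iInf _).mp this j)

theorem inner_exp_apply_of_symmetric {ξ : V →L[ℝ] V} (hξ : (ξ : V →ₗ[ℝ] V).IsSymmetric)
    {e : V} {c : ℝ} (he : ξ e = c • e) (v : V) :
    ⟪e, NormedSpace.exp ξ v⟫_ℝ = Real.exp c * ⟪e, v⟫_ℝ := by
  have : CompleteSpace V := FiniteDimensional.complete ℝ V
  have hpow : ∀ n : ℕ, ⟪e, (ξ ^ n) v⟫_ℝ = c ^ n * ⟪e, v⟫_ℝ := by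
    intro n
    induction n with
    | zero => simp
    | succ n ih =>
      have h := hξ e ((ξ ^ n) v)
      simp only [ContinuousLinearMap.coe_coe] at h
      rw [pow_succ', show (ξ * ξ ^ n) v = ξ ((ξ ^ n) v) from rfl, ← h, he, real_inner_smul_left, ih, pow_succ']
      ring
  have h1 := (NormedSpace.exp_series_hasSum_exp' (𝕂 := ℝ) ξ).mapL
    ((innerSL ℝ e).comp (ContinuousLinearMap.apply ℝ V v))
  have h2 := (NormedSpace.exp_series_hasSum_exp' (𝕂 := ℝ) c).mul_right ⟪e, v⟫_ℝ
  rw [Real.exp_eq_exp_ℝ]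
  refine h1.unique ?_
  convert! h2 using 1
  ext n
  change ⟪e, ((n.factorial : ℝ)⁻¹ • ξ ^ n) v⟫_ℝ = _
  rw [smul_apply, real_inner_smul_right, hpow, smul_eq_mul, mul_assoc]

/-- Symmetric commuting operators `𝔞` have an orthonormal basis of weight vectors; the weight of a
unit weight vector is its value under the gradient map. -/
theorem exists_weight_basis [IsLieAbelian 𝔞]
    (hsymm : ∀ ξ ∈ 𝔞, ((ξ : V →L[ℝ] V) : V →ₗ[ℝ] V).IsSymmetric) :
    ∃ b : OrthonormalBasis (Fin (Module.finrank ℝ V)) ℝ V, ∀ i, ∀ ξ : 𝔞,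
      (ξ : V →L[ℝ] V) (b i) = gradientMap 𝔞 (b i) ξ • b i := by
  obtain ⟨b, hb⟩ := exists_orthonormalBasis_joint_eigenvectors
    (fun ξ : 𝔞 => ((ξ : V →L[ℝ] V) : V →ₗ[ℝ] V)) (fun ξ => hsymm ξ ξ.2) (fun ξ η _ => by
      have := commute_of_mem 𝔞 ξ.2 η.2
      ext y
      exact congrArg (fun f : V →L[ℝ] V => f y) this)
  refine ⟨b, fun i ξ => ?_⟩
  obtain ⟨χ, hχ⟩ := hb i
  have h : (ξ : V →L[ℝ] V) (b i) = χ ξ • b i := hχ ξ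
  have : gradientMap 𝔞 (b i) ξ = χ ξ := by
    change ⟪(ξ : V →L[ℝ] V) (b i), b i⟫_ℝ = χ ξ
    rw [h, real_inner_smul_left, real_inner_self_eq_norm_sq, b.norm_eq_one]
    simp
  rw [this, h]

/-- If `β` is a nonnegative combination of the weights occurring in `v`, then the function
`ξ ↦ ‖exp ξ v‖² / 2 - β ξ` on `𝔞` bounds the norm of `exp ξ v`. -/
theorem exists_norm_sq_le_add {ι : Type*} [Fintype ι]
    (hsymm : ∀ ξ ∈ 𝔞, ((ξ : V →L[ℝ] V) : V →ₗ[ℝ] V).IsSymmetric)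
    (b : OrthonormalBasis ι ℝ V)
    (hb : ∀ i, ∀ ξ : 𝔞, (ξ : V →L[ℝ] V) (b i) = gradientMap 𝔞 (b i) ξ • b i) (v : V)
    {s : Finset ι} (hs : ∀ i ∈ s, ⟪b i, v⟫_ℝ ≠ 0) {β : Module.Dual ℝ 𝔞}
    (hβ : β ∈ coneOf s fun i => gradientMap 𝔞 (b i)) :
    ∃ C : ℝ, ∀ ξ : 𝔞, ‖NormedSpace.exp (ξ : V →L[ℝ] V) v‖ ^ 2 / 4 - C ≤
      ‖NormedSpace.exp (ξ : V →L[ℝ] V) v‖ ^ 2 / 2 - β ξ := by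
  classical
  obtain ⟨c, hc, rfl⟩ := hβ
  -- The exponential beats the linear term. Spending only a quarter of the squared norm leaves the
  -- other quarter to control the norm.
  have hbd : ∀ i, ∃ C : ℝ, i ∈ s → ∀ t : ℝ,
      c i * t ≤ (Real.exp t * ⟪b i, v⟫_ℝ) ^ 2 / 4 + C := by
    intro i
    by_cases hi : i ∈ s
    · have ha : 0 < ⟪b i, v⟫_ℝ ^ 2 := by have := hs i hi; positivity
      refine ⟨c i ^ 2 / ⟪b i, v⟫_ℝ ^ 2, fun _ t => ?_⟩
      rcases le_or_gt t 0 with ht | ht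
      · exact (mul_nonpos_of_nonneg_of_nonpos (hc i) ht).trans (by positivity)
      · have h1 : t ^ 2 ≤ Real.exp t ^ 2 :=
          pow_le_pow_left₀ ht.le (by linarith [Real.add_one_le_exp t]) 2
        have h2 : c i * t ≤ t ^ 2 * ⟪b i, v⟫_ℝ ^ 2 / 4 + c i ^ 2 / ⟪b i, v⟫_ℝ ^ 2 := by
          rw [← sub_nonneg]
          have : t ^ 2 * ⟪b i, v⟫_ℝ ^ 2 / 4 + c i ^ 2 / ⟪b i, v⟫_ℝ ^ 2 - c i * t
              = (t * ⟪b i, v⟫_ℝ / 2 - c i / ⟪b i, v⟫_ℝ) ^ 2 := by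
            field_simp [hs i hi]
            ring
          rw [this]
          positivity
        have h3 := mul_le_mul_of_nonneg_right h1 ha.le
        rw [mul_pow]
        linarith
    · exact ⟨0, fun h => absurd h hi⟩
  choose C hC using hbd
  refine ⟨∑ i ∈ s, C i, fun ξ => ?_⟩
  have h1 : ∑ i ∈ s, c i * gradientMap 𝔞 (b i) ξ ≤
      ∑ i ∈ s, ((⟪b i, NormedSpace.exp (ξ : V →L[ℝ] V) v⟫_ℝ) ^ 2 / 4 + C i) := by
    refine Finset.sum_le_sum fun i hi => ?_
    rw [inner_exp_apply_of_symmetric (hsymm ξ ξ.2) (hb i ξ)]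
    exact hC i hi _
  have h2 : ∑ i ∈ s, (⟪b i, NormedSpace.exp (ξ : V →L[ℝ] V) v⟫_ℝ) ^ 2 ≤
      ‖NormedSpace.exp (ξ : V →L[ℝ] V) v‖ ^ 2 := by
    rw [← b.sum_sq_inner_right]
    exact Finset.sum_le_univ_sum_of_nonneg fun i => sq_nonneg _
  rw [Finset.sum_add_distrib, ← Finset.sum_div] at h1
  rw [LinearMap.sum_apply]
  simp only [LinearMap.smul_apply, smul_eq_mul]
  linarith

/-- Every nonnegative combination of the weights occurring in `v` is a value of the gradient map
on the closure of the orbit of `v` under `exp 𝔞`. -/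
theorem coneOf_subset_image_closure_orbit [IsLieAbelian 𝔞] {ι : Type*} [Fintype ι]
    (hsymm : ∀ ξ ∈ 𝔞, ((ξ : V →L[ℝ] V) : V →ₗ[ℝ] V).IsSymmetric)
    (b : OrthonormalBasis ι ℝ V)
    (hb : ∀ i, ∀ ξ : 𝔞, (ξ : V →L[ℝ] V) (b i) = gradientMap 𝔞 (b i) ξ • b i) (v : V)
    {s : Finset ι} (hs : ∀ i ∈ s, ⟪b i, v⟫_ℝ ≠ 0) :
    coneOf s (fun i => gradientMap 𝔞 (b i)) ⊆
      gradientMap 𝔞 '' closure (MulAction.orbit (expGroup 𝔞) v) := by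
  intro β hβ
  obtain ⟨C, hC⟩ := exists_norm_sq_le_add hsymm b hb v hs hβ
  have : CompleteSpace V := FiniteDimensional.complete ℝ V
  let _ : NormedAlgebra ℚ (V →L[ℝ] V) := NormedAlgebra.restrictScalars ℚ ℝ (V →L[ℝ] V)
  let y : 𝔞 → V := fun ξ => NormedSpace.exp (ξ : V →L[ℝ] V) v
  let F : 𝔞 → ℝ := fun ξ => ‖y ξ‖ ^ 2 / 2 - β ξ
  have hbdd : BddBelow (Set.range F) := by
    refine ⟨-C, ?_⟩
    rintro _ ⟨ξ, rfl⟩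
    have := hC ξ
    have : 0 ≤ ‖NormedSpace.exp (ξ : V →L[ℝ] V) v‖ ^ 2 := by positivity
    change -C ≤ ‖NormedSpace.exp (ξ : V →L[ℝ] V) v‖ ^ 2 / 2 - β ξ
    linarith
  obtain ⟨f, -, hflim, hfF⟩ := exists_seq_tendsto_sInf (Set.range_nonempty F) hbdd
  choose ξ hξ using hfF
  obtain ⟨M, hM⟩ := hflim.bddAbove_range
  have hball : ∀ n, y (ξ n) ∈ Metric.closedBall (0 : V) (√(4 * (M + C))) := by
    intro n
    rw [mem_closedBall_zero_iff]
    refine Real.le_sqrt_of_sq_le ?_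
    have h1 : ‖y (ξ n)‖ ^ 2 / 4 - C ≤ F (ξ n) := hC (ξ n)
    have h2 : F (ξ n) ≤ M := hξ n ▸ hM ⟨n, rfl⟩
    linarith
  -- The `ξ n` themselves may diverge; only the points `exp (ξ n) v` are bounded.
  obtain ⟨w, -, φ, hφ, hw⟩ := (isCompact_closedBall (0 : V) _).tendsto_subseq hball
  have hF : ∀ η ζ : 𝔞, F (η + ζ) = ‖NormedSpace.exp (η : V →L[ℝ] V) (y ζ)‖ ^ 2 / 2 - β η - β ζ := by
    intro η ζ
    have : y (η + ζ) = NormedSpace.exp (η : V →L[ℝ] V) (y ζ) := by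
      change NormedSpace.exp ((η : V →L[ℝ] V) + (ζ : V →L[ℝ] V)) v = _
      rw [NormedSpace.exp_add_of_commute (commute_of_mem 𝔞 η.2 ζ.2)]
      rfl
    change ‖y (η + ζ)‖ ^ 2 / 2 - β (η + ζ) = _
    rw [this, map_add, sub_sub]
  -- Shifting `ξ n` by `η` changes `F` by the Kempf-Ness function at `y (ξ n)` minus `β η`. Along a
  -- minimising sequence this change is nonnegative in the limit.
  have hmin : ∀ η : 𝔞, β η ≤ kempfNess w (NormedSpace.exp (η : V →L[ℝ] V)) := by
    intro η
    have h1 : Filter.Tendsto (fun n => kempfNess (y (ξ (φ n))) (NormedSpace.exp (η : V →L[ℝ] V)))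
        Filter.atTop (nhds (kempfNess w (NormedSpace.exp (η : V →L[ℝ] V)))) := by
      have hcont : Continuous fun z => kempfNess z (NormedSpace.exp (η : V →L[ℝ] V)) := by
        unfold kempfNess
        fun_prop
      exact (hcont.tendsto w).comp hw
    have h2 := (hflim.comp hφ.tendsto_atTop).const_sub (sInf (Set.range F) + β η)
    rw [add_sub_cancel_left] at h2
    refine le_of_tendsto_of_tendsto' h2 h1 fun n => ?_
    have h3 : sInf (Set.range F) ≤ F (η + ξ (φ n)) := csInf_le hbdd ⟨_, rfl⟩
    have h4 : F (ξ (φ n)) = f (φ n) := hξ _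
    rw [hF] at h3
    change ‖y (ξ (φ n))‖ ^ 2 / 2 - β (ξ (φ n)) = f (φ n) at h4
    simp only [Function.comp_apply, kempfNess]
    linarith
  refine ⟨w, mem_closure_of_tendsto hw (Filter.Eventually.of_forall fun n => ?_), ?_⟩
  · obtain ⟨g, hg⟩ := exists_unit_exp (ξ (φ n) : V →L[ℝ] V)
    exact ⟨⟨g, (ξ (φ n) : V →L[ℝ] V), (ξ (φ n)).2, hg⟩, congrArg (fun T : V →L[ℝ] V => T v) hg⟩
  · ext η
    have hd := (hasDerivAt_kempfNess 𝔞 w η).sub ((hasDerivAt_id (0 : ℝ)).mul_const (β η))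
    -- The difference vanishes at `t = 0` and is nonnegative, so its derivative there, `gradientMap
    -- 𝔞 w η - β η`, is zero.
    have hloc : IsLocalMin ((fun t : ℝ => kempfNess w (NormedSpace.exp (t • (η : V →L[ℝ] V)))) -
        fun t : ℝ => id t * β η) 0 := by
      refine Filter.Eventually.of_forall fun t => ?_
      have := hmin (t • η)
      rw [map_smul] at this
      simp only [Pi.sub_apply, id, zero_smul, NormedSpace.exp_zero, zero_mul, sub_zero]
      have h0 : kempfNess w 1 = 0 := by simp [kempfNess]
      rw [h0]
      exact sub_nonneg.mpr this
    have := hloc.hasDerivAt_eq_zero hd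
    linarith

end Weights

end GradientMap

/-! ### The main theorem -/

open GradientMap in
theorem mainTheorem3 {V : Type*} [NormedAddCommGroup V] [InnerProductSpace ℝ V]
    [FiniteDimensional ℝ V] (G : Subgroup (V →L[ℝ] V)ˣ)
    (hclosed : IsClosed (G : Set (V →L[ℝ] V)ˣ))
    (hconn : IsConnected (G : Set (V →L[ℝ] V)ˣ))
    (htrans : GradientMap.ClosedUnderTranspose G)
    (𝔞 : LieSubalgebra ℝ (V →L[ℝ] V)) [IsLieAbelian 𝔞]
    (h𝔞 : (𝔞 : Set (V →L[ℝ] V)) ⊆ GradientMap.symPart G) (x : V) :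
    (∃ v ∈ MulAction.orbit G x,
      GradientMap.gradientMap 𝔞 '' closure (MulAction.orbit G x) =
        GradientMap.gradientMap 𝔞 '' closure (MulAction.orbit (GradientMap.expGroup 𝔞) v)) ∧
    GradientMap.IsPolyhedralCone
      (GradientMap.gradientMap 𝔞 '' closure (MulAction.orbit G x)) := by
  classical
  have hsymm : ∀ ξ ∈ 𝔞, ((ξ : V →L[ℝ] V) : V →ₗ[ℝ] V).IsSymmetric := fun ξ hξ => (h𝔞 hξ).2
  obtain ⟨b, hb⟩ := exists_weight_basis hsymm
  -- the weights occurring in the orbit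
  let s : Finset (Fin (Module.finrank ℝ V)) :=
    Finset.univ.filter fun i => ∃ y ∈ MulAction.orbit G x, ⟪b i, y⟫_ℝ ≠ 0
  have hpre : IsPreconnected (MulAction.orbit G x) := by
    have := hconn.isPreconnected.image (fun g : (V →L[ℝ] V)ˣ => (g : V →L[ℝ] V) x)
      (Units.continuous_val.clm_apply continuous_const).continuousOn
    convert! this
    ext y
    exact ⟨fun ⟨g, hg⟩ => ⟨g, g.2, hg⟩, fun ⟨g, hg, h⟩ => ⟨⟨g, hg⟩, h⟩⟩
  obtain ⟨v, hvO, hv⟩ : ∃ v ∈ MulAction.orbit G x, ∀ i ∈ s, ⟪b i, v⟫_ℝ ≠ 0 := by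
    -- Otherwise the coordinate hyperplanes indexed by `s` cover the orbit, so one contains it,
    -- contrary to the choice of `s`.
    by_contra! hcon
    obtain ⟨i, hi⟩ := exists_orbit_subset_of_subset_iUnion G x hpre
      (fun i : s => (innerSL ℝ (b i)).ker) (fun y hy => by
        obtain ⟨i, his, hi⟩ := hcon y hy
        exact Set.mem_iUnion.mpr ⟨⟨i, his⟩, hi⟩)
    obtain ⟨y, hy, hne⟩ := (Finset.mem_filter.mp i.2).2
    exact hne (hi hy)
  have hA : closure (MulAction.orbit (expGroup 𝔞) v) ⊆ closure (MulAction.orbit G x) := by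
    refine closure_mono ?_
    rw [← MulAction.orbit_eq_iff.mpr hvO]
    rintro _ ⟨⟨u, ξ, hξ, hu⟩, rfl⟩
    obtain ⟨g, hg, hgu⟩ := (h𝔞 hξ).1 1
    rw [one_smul, ← hu] at hgu
    exact ⟨⟨u, Units.ext hgu ▸ hg⟩, rfl⟩
  have hcone := coneOf_subset_image_closure_orbit hsymm b hb v hv
  have hG : gradientMap 𝔞 '' closure (MulAction.orbit G x) ⊆
      coneOf s fun i => gradientMap 𝔞 (b i) := by
    rintro _ ⟨y, hy, rfl⟩
    refine ⟨fun i => ⟪b i, y⟫_ℝ ^ 2, fun i => sq_nonneg _, ?_⟩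
    rw [gradientMap_eq_sum hsymm b hb]
    refine (Finset.sum_subset (Finset.subset_univ s) fun i _ his => ?_).symm
    have h0 : ∀ z ∈ closure (MulAction.orbit G x), ⟪b i, z⟫_ℝ = 0 := by
      refine closure_minimal (t := {z | ⟪b i, z⟫_ℝ = 0}) (fun z hz => ?_)
        (isClosed_eq (by fun_prop) continuous_const)
      by_contra hne
      exact his (Finset.mem_filter.mpr ⟨Finset.mem_univ _, z, hz, hne⟩)
    rw [h0 y hy, zero_pow two_ne_zero, zero_smul]
  have hAG := Set.image_mono (f := gradientMap 𝔞) hA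
  have heq := hG.antisymm (hcone.trans hAG)
  refine ⟨⟨v, hvO, (hG.trans hcone).antisymm hAG⟩, ?_⟩
  rw [heq]
  exact isPolyhedralCone_coneOf s _
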